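/- For a real number $x$ let $\Vert x\Vert=\min_{m\in\mathbb{Z}}|x-m|$ denote the distance from $x$ to the closest integer. For real $\alpha\neq 0$ and $\zeta>1$ put $$\sigma_n(\alpha,\zeta)=-\frac{\log\Vert\alpha\zeta^n\Vert}{\log|\alpha\zeta^n|}\in[-\infty,\infty]\qquad(n \text{ large enough that } |\alpha\zeta^n|>1),$$ with $\log 0=-\infty$ (so $\sigma_n(\alpha,\zeta)=+\infty$ if $\alpha\zeta^n$ is an integer), and let $\underline{\sigma}(\alpha,\zeta)=\liminf_{n\to\infty}\sigma_n(\alpha,\zeta)$. **Theorem.** Let $\zeta>1$ be a transcendental real number. Then $\underline{\sigma}(\alpha,\zeta)=0$ for every real $\alpha\neq 0$. That is, $\alpha\zeta^n$ does not tend to integers at an exponential rate: for no real $C$ and no $0<r<1$ does $\Vert\alpha\zeta^n\Vert\le C r^n$ hold for all sufficiently large $n$. -/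

import Mathlib

open Filter

/-- The distance `‖x‖` from a real number to the closest integer
(it does not depend on how ties are broken). -/
noncomputable def distNearestInt (x : ℝ) : ℝ := |x - (round x : ℝ)|

/-- `σ_n(α, ζ) = - log ‖α ζ ^ n‖ / log |α ζ ^ n|`, as an extended real number.
Here `ENNReal.log 0 = ⊥`, so that for `|α ζ ^ n| > 1` the value is `⊤` exactly
when `α ζ ^ n` is an integer. -/
noncomputable def sigmaSeq (α ζ : ℝ) (n : ℕ) : EReal :=
  -(ENNReal.log (ENNReal.ofReal (distNearestInt (α * ζ ^ n))) /
      ((Real.log |α * ζ ^ n| : ℝ) : EReal))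

/-- The lower approximation constant `liminf_{n → ∞} σ_n(α, ζ)`. -/
noncomputable def lowerSigma (α ζ : ℝ) : EReal :=
  liminf (fun n : ℕ => sigmaSeq α ζ n) atTop

/-! Write `α ζ ^ n = u n + e n` with `u n` the nearest integer, and suppose `e n` decays
exponentially. Siegel's lemma has exponent `1 / n` here, so its bound on the relation `t` among `u
n, …, u (2 n)` does not grow with `n`. With `p = ∑ t j ζ ^ j`, the shifted sums `v m` are then
integers within `K r ^ m` of `α ζ ^ m p`, with `K` independent of `n`. For large `n`, `v m = 0`
forces `|v (m + 1)| < 1`, so every later `v m` vanishes. Hence `α ζ ^ m p → 0`, so `p = 0` and `ζ`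
is algebraic. -/

/-- A consequence of Siegel's lemma: an integer sequence of at most exponential growth satisfies,
for every `n ≥ 1`, a nontrivial linear relation between the `n + 1` terms from the `n`-th on
whose coefficients are bounded independently of `n`. -/
theorem exists_bounded_int_relation (u : ℕ → ℤ) {B w : ℝ} (hB : 1 ≤ B) (hw : 1 ≤ w)
    (hu : ∀ m, |(u m : ℝ)| ≤ B * w ^ m) {n : ℕ} (hn : 1 ≤ n) :
    ∃ t : Fin (n + 1) → ℤ, t ≠ 0 ∧ ∑ j, t j * u (n + j) = 0 ∧
      ∀ j, |(t j : ℝ)| ≤ B * (2 * w ^ 2) := by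
  let _ : SeminormedAddCommGroup (Matrix (Fin 1) (Fin (n + 1)) ℤ) :=
    Matrix.seminormedAddCommGroup
  set A : Matrix (Fin 1) (Fin (n + 1)) ℤ := Matrix.of fun _ j => u (n + j) with hA
  obtain ⟨t, ht0, htA, ht⟩ := Int.Matrix.exists_ne_zero_int_vec_norm_le A
    (by simp only [Fintype.card_fin]; omega) (by simp)
  have hw0 : (0 : ℝ) < w := by linarith
  -- The indices `n + j` reach at most `2 n`, hence `w ^ 2`.
  have hmax : max 1 ‖A‖ ≤ B * (w ^ 2) ^ n := by
    refine max_le (one_le_mul_of_one_le_of_one_le hB (one_le_pow₀ (one_le_pow₀ hw))) ?_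
    refine (Matrix.norm_le_iff (by positivity)).2 fun i j => ?_
    rw [hA, Matrix.of_apply, Int.norm_eq_abs, ← pow_mul]
    refine (hu _).trans ?_
    gcongr
    omega
  have hcard : ((n + 1 : ℕ) : ℝ) ≤ 2 ^ n := by
    exact_mod_cast Nat.lt_two_pow_self (n := n)
  have hroot : ‖t‖ ≤ B * (2 * w ^ 2) := by
    refine ht.trans ?_
    have hexp : ((Fintype.card (Fin 1) : ℝ) /
        ((Fintype.card (Fin (n + 1)) : ℝ) - (Fintype.card (Fin 1) : ℝ))) = (n : ℝ)⁻¹ := by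
      simp
    rw [hexp, Fintype.card_fin]
    have hle : ((n + 1 : ℕ) : ℝ) * max 1 ‖A‖ ≤ (B * (2 * w ^ 2)) ^ n := by
      calc ((n + 1 : ℕ) : ℝ) * max 1 ‖A‖ ≤ 2 ^ n * (B * (w ^ 2) ^ n) := by gcongr
        _ ≤ 2 ^ n * (B ^ n * (w ^ 2) ^ n) := by
          gcongr
          exact le_self_pow₀ hB (by omega)
        _ = (B * (2 * w ^ 2)) ^ n := by ring
    calc (((n + 1 : ℕ) : ℝ) * max 1 ‖A‖) ^ (n : ℝ)⁻¹
        ≤ ((B * (2 * w ^ 2)) ^ n) ^ (n : ℝ)⁻¹ := by gcongr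
      _ = B * (2 * w ^ 2) := Real.pow_rpow_inv_natCast (by positivity) (by omega)
  refine ⟨t, ht0, ?_, fun j => ?_⟩
  · have := congrFun htA 0
    simpa [Matrix.mulVec, dotProduct, hA, mul_comm] using this
  · rw [← Int.norm_eq_abs]
    exact (norm_le_pi_norm t j).trans hroot

/-- A linear combination with bounded coefficients of exponentially small terms is
exponentially small, uniformly in the number of terms. -/
theorem abs_sum_mul_le_of_geometric {e : ℕ → ℝ} {C r H : ℝ} {N k m : ℕ} (hr : 0 < r) (hr1 : r < 1)
    (hC : 0 ≤ C) (he : ∀ n ≥ N, |e n| ≤ C * r ^ n) (hm : N ≤ m) {t : Fin k → ℤ}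
    (ht : ∀ j, |(t j : ℝ)| ≤ H) (hH : 0 ≤ H) :
    |∑ j, (t j : ℝ) * e (m + j)| ≤ H * C / (1 - r) * r ^ m := by
  have hsum : ∑ j : Fin k, r ^ (j : ℕ) ≤ (1 - r)⁻¹ := by
    rw [Fin.sum_univ_eq_sum_range (fun j => r ^ j) k, ← tsum_geometric_of_lt_one hr.le hr1]
    exact (summable_geometric_of_lt_one hr.le hr1).sum_le_tsum _ fun _ _ => by positivity
  calc |∑ j, (t j : ℝ) * e (m + j)| ≤ ∑ j, |(t j : ℝ) * e (m + j)| :=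
        Finset.abs_sum_le_sum_abs _ _
    _ ≤ ∑ j : Fin k, H * (C * r ^ m) * r ^ (j : ℕ) := by
        gcongr with j
        rw [abs_mul, mul_assoc, mul_assoc C, ← pow_add]
        exact mul_le_mul (ht j) (he _ (by omega)) (abs_nonneg _) hH
    _ = H * (C * r ^ m) * ∑ j : Fin k, r ^ (j : ℕ) := by rw [Finset.mul_sum]
    _ ≤ H * (C * r ^ m) * (1 - r)⁻¹ := by gcongr
    _ = H * C / (1 - r) * r ^ m := by ring

/-- If `α ζ ^ n` approaches integers exponentially fast, then `ζ` is algebraic. -/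
theorem isAlgebraic_of_eventually_distNearestInt_le {ζ α C r : ℝ} (hζ : 1 < ζ) (hα : α ≠ 0)
    (hr : 0 < r) (hr1 : r < 1)
    (h : ∀ᶠ n : ℕ in atTop, distNearestInt (α * ζ ^ n) ≤ C * r ^ n) : IsAlgebraic ℚ ζ := by
  obtain ⟨N, hN⟩ := eventually_atTop.1 h
  have hC : 0 ≤ C := nonneg_of_mul_nonneg_left
    ((abs_nonneg _).trans (hN N le_rfl)) (pow_pos hr N)
  have hζ0 : 0 < ζ := by linarith
  set u : ℕ → ℤ := fun n => round (α * ζ ^ n) with hu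
  set e : ℕ → ℝ := fun n => α * ζ ^ n - u n with he
  have heN : ∀ n ≥ N, |e n| ≤ C * r ^ n := hN
  have hu_le : ∀ m, |(u m : ℝ)| ≤ (|α| + 1) * ζ ^ m := fun m => by
    have h1 : |α * ζ ^ m - u m| ≤ 1 / 2 := abs_sub_round _
    have h2 : |(u m : ℝ)| ≤ |α * ζ ^ m| + |α * ζ ^ m - u m| := by
      have := abs_sub (α * ζ ^ m) (α * ζ ^ m - u m)
      simpa using this
    rw [abs_mul, abs_of_pos (pow_pos hζ0 m)] at h2
    have h3 : 1 ≤ ζ ^ m := one_le_pow₀ hζ.le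
    linarith
  set H : ℝ := (|α| + 1) * (2 * ζ ^ 2) with hH
  have hH0 : 0 ≤ H := by positivity
  set K : ℝ := H * C / (1 - r) with hK
  have hK0 : 0 ≤ K := div_nonneg (mul_nonneg hH0 hC) (by linarith)
  have hlim (c : ℝ) : Tendsto (fun n : ℕ => c * r ^ n) atTop (nhds 0) := by
    simpa using (tendsto_pow_atTop_nhds_zero_of_lt_one hr.le hr1).const_mul c
  -- Not circular: `K` was fixed before `n`, as `H` bounds the relation for every `n`.
  obtain ⟨n, hn_lt, hn1, hnN⟩ := (((hlim (K * (r + ζ))).eventually_lt_const one_pos).and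
    ((eventually_ge_atTop 1).and (eventually_ge_atTop N))).exists
  obtain ⟨t, ht0, htn, htH⟩ := exists_bounded_int_relation u
    (by linarith [abs_nonneg α] : 1 ≤ |α| + 1) hζ.le hu_le hn1
  set v : ℕ → ℤ := fun m => ∑ j, t j * u (m + j) with hv
  set p : ℝ := ∑ j, (t j : ℝ) * ζ ^ (j : ℕ) with hp
  have hvp : ∀ m, α * ζ ^ m * p - v m = ∑ j, (t j : ℝ) * e (m + j) := fun m => by
    simp only [hv, hp, he, Int.cast_sum, Int.cast_mul, Finset.mul_sum, mul_sub,
      Finset.sum_sub_distrib]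
    congr 1
    exact Finset.sum_congr rfl fun j _ => by ring
  have hsmall : ∀ m ≥ N, |α * ζ ^ m * p - v m| ≤ K * r ^ m := fun m hm => by
    rw [hvp]
    exact abs_sum_mul_le_of_geometric hr hr1 hC heN hm htH hH0
  have hv0 : ∀ m ≥ n, v m = 0 := by
    intro m hm
    induction m, hm using Nat.le_induction with
    | base => exact htn
    | succ m hm ih =>
      have h1 := hsmall m (by omega)
      have h2 := hsmall (m + 1) (by omega)
      rw [ih, Int.cast_zero, sub_zero] at h1
      -- Since `v m = 0`, the main term at `m + 1` is `ζ` times an error at `m`.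
      have h3 : (v (m + 1) : ℝ) =
          ζ * (α * ζ ^ m * p) - (α * ζ ^ (m + 1) * p - v (m + 1)) := by ring
      have h4 : |(v (m + 1) : ℝ)| < 1 := by
        calc |(v (m + 1) : ℝ)|
            ≤ |ζ * (α * ζ ^ m * p)| + |α * ζ ^ (m + 1) * p - v (m + 1)| := by
              exact (congrArg abs h3).trans_le (abs_sub _ _)
          _ ≤ ζ * (K * r ^ m) + K * r ^ (m + 1) := by
              rw [abs_mul, abs_of_pos hζ0]; gcongr
          _ = K * (r + ζ) * r ^ m := by ring
          _ ≤ K * (r + ζ) * r ^ n := by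
              gcongr ?_ * ?_
              exact pow_le_pow_of_le_one hr.le hr1.le hm
          _ < 1 := hn_lt
      exact Int.abs_lt_one_iff.1 (by exact_mod_cast h4)
  have hαp : |α * p| ≤ 0 := by
    refine ge_of_tendsto (hlim K) ?_
    filter_upwards [eventually_ge_atTop n] with m hm
    have h1 := hsmall m (by omega)
    rw [hv0 m hm, Int.cast_zero, sub_zero] at h1
    refine le_trans ?_ h1
    rw [mul_right_comm, abs_mul _ (ζ ^ m), abs_of_pos (pow_pos hζ0 m)]
    exact le_mul_of_one_le_right (abs_nonneg _) (one_le_pow₀ hζ.le)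
  have hp0 : p = 0 :=
    (mul_eq_zero.1 (abs_eq_zero.1 (le_antisymm hαp (abs_nonneg _)))).resolve_left hα
  refine IsAlgebraic.extendScalars (R := ℤ) (algebraMap ℤ ℚ).injective_int ?_
  refine ⟨∑ j : Fin (n + 1), Polynomial.monomial (j : ℕ) (t j), fun hzero => ht0 ?_, ?_⟩
  · ext i
    have := congrArg (Polynomial.coeff · (i : ℕ)) hzero
    simpa [Polynomial.finsetSum_coeff, Polynomial.coeff_monomial, Fin.val_inj] using this
  · simpa [Polynomial.aeval_monomial, hp] using hp0

theorem eventually_one_lt_abs_mul_pow {ζ α : ℝ} (hζ : 1 < ζ) (hα : α ≠ 0) :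
    ∀ᶠ n : ℕ in atTop, 1 < |α * ζ ^ n| := by
  have h := (tendsto_pow_atTop_atTop_of_one_lt hζ).const_mul_atTop (abs_pos.2 hα)
  filter_upwards [h.eventually_gt_atTop 1] with n hn
  rwa [abs_mul, abs_of_pos (pow_pos (by linarith : 0 < ζ) n)]

theorem sigmaSeq_nonneg {ζ α : ℝ} {n : ℕ} (hn : 1 < |α * ζ ^ n|) : 0 ≤ sigmaSeq α ζ n := by
  have hd : distNearestInt (α * ζ ^ n) ≤ 1 := (abs_sub_round _).trans (by norm_num)
  rw [sigmaSeq, EReal.le_neg, neg_zero]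
  refine EReal.div_nonpos_of_nonpos_of_nonneg ?_ (EReal.coe_nonneg.2 (Real.log_pos hn).le)
  rw [← ENNReal.log_one]
  exact ENNReal.log_monotone (ENNReal.ofReal_le_one.2 hd)

theorem distNearestInt_le_of_lt_sigmaSeq {ζ α c : ℝ} {n : ℕ} (hn : 1 < |α * ζ ^ n|)
    (h : (c : EReal) < sigmaSeq α ζ n) :
    distNearestInt (α * ζ ^ n) ≤ |α * ζ ^ n| ^ (-c) := by
  have hx : 0 < |α * ζ ^ n| := one_pos.trans hn
  have hd : 0 ≤ distNearestInt (α * ζ ^ n) := abs_nonneg _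
  obtain h0 | h0 := hd.eq_or_lt
  · rw [← h0]; positivity
  · rw [sigmaSeq, ENNReal.log_ofReal_of_pos h0, ← EReal.coe_div, ← EReal.coe_neg,
      EReal.coe_lt_coe_iff, ← neg_div, lt_div_iff₀ (Real.log_pos hn)] at h
    rw [← Real.log_le_log_iff h0 (by positivity), Real.log_rpow hx]
    linarith

theorem mainTheorem8 (ζ : ℝ) (hζ : 1 < ζ) (hζt : Transcendental ℚ ζ)
    (α : ℝ) (hα : α ≠ 0) :
    lowerSigma α ζ = 0 ∧
      ∀ C r : ℝ, 0 < r → r < 1 →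
        ¬ ∀ᶠ n : ℕ in atTop, distNearestInt (α * ζ ^ n) ≤ C * r ^ n := by
  have hrate : ∀ C r : ℝ, 0 < r → r < 1 →
      ¬ ∀ᶠ n : ℕ in atTop, distNearestInt (α * ζ ^ n) ≤ C * r ^ n := fun C r hr hr1 h =>
    hζt (isAlgebraic_of_eventually_distNearestInt_le hζ hα hr hr1 h)
  refine ⟨le_antisymm ?_ ?_, hrate⟩
  · by_contra! hpos
    obtain ⟨c, hc0, hc⟩ := EReal.lt_iff_exists_real_btwn.1 hpos
    have hζ0 : 0 < ζ := by linarith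
    -- A bound `|α ζ ^ n| ^ (-c)` is geometric in `n`, with ratio `ζ ^ (-c)`.
    refine hrate (|α| ^ (-c)) (ζ ^ (-c)) (by positivity)
      (Real.rpow_lt_one_of_one_lt_of_neg hζ (by simpa using hc0)) ?_
    filter_upwards [eventually_lt_of_lt_liminf hc, eventually_one_lt_abs_mul_pow hζ hα]
      with n hcn hn
    refine (distNearestInt_le_of_lt_sigmaSeq hn hcn).trans_eq ?_
    rw [abs_mul, abs_of_pos (pow_pos hζ0 n), Real.mul_rpow (abs_nonneg _) (by positivity),
      Real.rpow_pow_comm hζ0.le]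
  · refine le_liminf_of_le (by isBoundedDefault) ?_
    filter_upwards [eventually_one_lt_abs_mul_pow hζ hα] with n hn
    exact sigmaSeq_nonneg hn
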